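/- For an integer $k$ let $(a)_k=\Gamma(a+k)/\Gamma(a)$ be the Pochhammer symbol, so that $(a)_{-j}=1/((a-1)(a-2)\cdots(a-j))$ for $j>0$, and let $$G_3(a,b|x,y)=\sum_{m,n\ge 0}\frac{(a)_{2n-m}\,(b)_{2m-n}}{m!\,n!}\,x^m y^n$$ be the Horn function. For $r\in\mathbb C$ the coefficients of $G_3(s,1-s|x,y)$ have finite limits as $s\to r$ (equal to the coefficients of $G_3(r,1-r|x,y)$ if $r\notin\mathbb Z$); for $r\in\mathbb Z$ the series $G_3(r,1-r|x,y)$ is understood with these limits as its coefficients. Put $$\Delta(x,y)=1+4x+4y+18xy-27x^2y^2,\qquad g(x,y)=-3y^2f(x,y)^2-2yf(x,y)+4y+1,$$ where $f$ is a holomorphic solution of $$y f(x,y)^3+f(x,y)^2-f(x,y)-x=0,\qquad f(0,0)=1 .$$ Then, for every $r\in\mathbb C$, $$G_3(r,1-r|x,y)=f(x,y)^r\sqrt{\frac{g(x,y)}{\Delta(x,y)}},$$ in the following sense. (a) There are $\rho>0$, independent of $r$, and such an $f$ on the bidisc $|x|<\rho$, $|y|<\rho$, for which $\Delta\neq 0$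 and neither $f$ nor $g/\Delta$ takes values in $(-\infty,0]$; for all $r\in\mathbb C$ and all $(x,y)$ in this bidisc the series converges absolutely and the formula holds with the principal branches of the power and the square root. (b) Let $r\in\mathbb C$, let $U\subseteq\mathbb C^2$ be a connected open set containing $(0,0)$ at every point of which the series $G_3(r,1-r|x,y)$ converges absolutely, and let $f,\ell,s$ be holomorphic on $U$ such that $f$ satisfies the cubic equation with $f(0,0)=1$, $e^{\ell}=f$ with $\ell(0,0)=0$, and $s^2\Delta=g$ with $s(0,0)=1$. Then $G_3(r,1-r|x,y)=e^{r\ell(x,y)}\,s(x,y)$ on $U$. -/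

import Mathlib

open Filter Topology

noncomputable section

/-- The Pochhammer symbol `(a)_k = Γ(a + k) / Γ(a)` with an integer index `k`, as a product:
`a (a + 1) ⋯ (a + k - 1)` for `k ≥ 0`, and `1 / ((a - 1) (a - 2) ⋯ (a - j))` for `k = -j < 0`. -/
def intPochhammer (a : ℂ) : ℤ → ℂ
  | Int.ofNat k => ∏ i ∈ Finset.range k, (a + i)
  | Int.negSucc k => (∏ i ∈ Finset.range (k + 1), (a - (i + 1)))⁻¹

/-- The coefficient of `x ^ m * y ^ n` in the Horn series
`G₃(a, b | x, y) = ∑ (a)_{2n-m} (b)_{2m-n} / (m! n!) x ^ m y ^ n`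
(meaningful when neither `a` nor `b` makes a Pochhammer symbol with negative index infinite,
in particular when `a` and `b` are not integers). -/
def hornG3Coeff (a b : ℂ) (m n : ℕ) : ℂ :=
  intPochhammer a (2 * (n : ℤ) - m) * intPochhammer b (2 * (m : ℤ) - n) /
    ((m.factorial : ℂ) * (n.factorial : ℂ))

/-- The coefficient of `x ^ m * y ^ n` in `G₃(r, 1 - r | x, y)`, for every complex `r`, integers
included, by continuity in the parameter. -/
def hornG3DiagCoeff (r : ℂ) (m n : ℕ) : ℂ :=
  limUnder (𝓝[≠] r) fun s : ℂ => hornG3Coeff s (1 - s) m n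

/-- The terms of the double series `G₃(r, 1 - r | x, y)`. -/
def hornG3DiagTerm (r x y : ℂ) (k : ℕ × ℕ) : ℂ :=
  hornG3DiagCoeff r k.1 k.2 * x ^ k.1 * y ^ k.2

/-- `g` as a polynomial in `y` and the value `f` of the root of the cubic. -/
def g3G (y f : ℂ) : ℂ := -3 * y ^ 2 * f ^ 2 - 2 * y * f + 4 * y + 1

/-- The discriminant `Δ(x, y)`. -/
def g3Delta (x y : ℂ) : ℂ := 1 + 4 * x + 4 * y + 18 * x * y - 27 * x ^ 2 * y ^ 2

/-- `f` is a holomorphic root of the cubic on `U`, on the branch with `f(0,0) = 1`. -/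
structure IsG3Root (U : Set (ℂ × ℂ)) (f : ℂ × ℂ → ℂ) : Prop where
  holo : DifferentiableOn ℂ f U
  cubic : ∀ p ∈ U, p.2 * f p ^ 3 + f p ^ 2 - f p - p.1 = 0
  base : f (0, 0) = 1

end

/-!
For `r ∉ ℤ` the reflection `(r)_k (1 - r)_{-k} = (-1) ^ k` turns the coefficients of
`G₃(r, 1 - r | x, y)` into polynomials in `r`, so the limits at integers exist. The same polynomials
arise in Lagrange inversion: the term of index `(m, n)` is `1 / (m! n!)` times the derivative of
order `m + n` at `z = 1` of `(x / z) ^ m (-y z ^ 2) ^ n z ^ (r - 1)`, so the series is the Lagrange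
expansion attached to the equation `w = 1 + x / w - y w ^ 2`, which is the cubic. Its sum is
`w ^ r / P'(w)` at the root `w` near `1`, where `P(w) = y w ^ 3 + w ^ 2 - w - x`, and
`g P'(w) ^ 2 = Δ` at a root of `P`.

In part (b) both sides are holomorphic along every complex line; an identity theorem that only
needs this much continues the local formula to the connected domain of convergence, and joint
holomorphy of the sum of the double series is never required.
-/

/-! ### Coefficients -/

theorem intPochhammer_add_one {a : ℂ} {j : ℤ} (ha : a + j ≠ 0) :
    intPochhammer a (j + 1) = intPochhammer a j * (a + j) := by
  obtain j | _ | j := j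
  · exact Finset.prod_range_succ _ _
  · have h : a - 1 ≠ 0 := by simpa [sub_eq_add_neg] using ha
    change intPochhammer a (Int.ofNat 0) = _
    simp [intPochhammer, ← sub_eq_add_neg, inv_mul_cancel₀ h]
  · have hcast : a + (Int.negSucc (j + 1) : ℤ) = a - ((j + 1 : ℕ) + 1) := by
      push_cast [Int.cast_negSucc]
      ring
    rw [hcast] at ha ⊢
    simp only [show Int.negSucc (j + 1) + 1 = Int.negSucc j by lia, intPochhammer,
      Finset.prod_range_succ _ (j + 1), mul_inv, mul_assoc, inv_mul_cancel₀ ha, mul_one]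

theorem intPochhammer_add_natCast {a : ℂ} {j : ℤ} {N : ℕ} (ha : ∀ i < N, a + j + i ≠ 0) :
    intPochhammer a (j + N) = intPochhammer a j * (ascPochhammer ℂ N).eval (a + j) := by
  induction N with
  | zero => simp
  | succ N ih =>
    have hN : a + (j + N : ℤ) ≠ 0 := by simpa [add_assoc] using ha N (by lia)
    rw [Nat.cast_succ, ← add_assoc, intPochhammer_add_one hN, ih fun i hi => ha i (by lia),
      ascPochhammer_succ_eval]
    push_cast
    ring

theorem intPochhammer_mul_intPochhammer_one_sub_neg {a : ℂ} (ha : a ∈ Complex.integerComplement)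
    (k : ℤ) : intPochhammer a k * intPochhammer (1 - a) (-k) = (-1) ^ k := by
  have hsucc (k : ℤ) : intPochhammer a (k + 1) * intPochhammer (1 - a) (-(k + 1)) =
      -(intPochhammer a k * intPochhammer (1 - a) (-k)) := by
    have hk : a + k ≠ 0 := Complex.integerComplement_add_ne_zero ha k
    have hk' : 1 - a + (-(k + 1) : ℤ) = -(a + k) := by push_cast; ring
    have h := intPochhammer_add_one (hk' ▸ neg_ne_zero.2 hk)
    rw [hk', show -(k + 1) + 1 = -k by ring] at h
    rw [intPochhammer_add_one hk, h]
    ring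
  induction k with
  | zero => simp [intPochhammer]
  | succ k ih => rw [hsucc, ih, zpow_add_one₀ (by norm_num), mul_neg_one]
  | pred k ih =>
    have h := hsucc (-(k : ℤ) - 1)
    rw [sub_add_cancel, ih] at h
    rw [zpow_sub_one₀ (by norm_num), h]
    norm_num

/-- The coefficient of `x ^ m * y ^ n` in `G₃(r, 1 - r | x, y)` written as a polynomial in `r`;
in terms of binomial coefficients it is
`(-1) ^ n * (r - 1 + 2 n - m choose m + n) * (m + n choose m)`. -/
noncomputable def hornG3PolyCoeff (r : ℂ) (m n : ℕ) : ℂ :=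
  (-1) ^ n * (descPochhammer ℂ (m + n)).eval (r - 1 + 2 * n - m) /
    ((m.factorial : ℂ) * (n.factorial : ℂ))

theorem continuous_hornG3PolyCoeff (m n : ℕ) : Continuous fun r => hornG3PolyCoeff r m n := by
  unfold hornG3PolyCoeff
  fun_prop

theorem hornG3Coeff_eq_hornG3PolyCoeff {s : ℂ} (hs : s ∈ Complex.integerComplement) (m n : ℕ) :
    hornG3Coeff s (1 - s) m n = hornG3PolyCoeff s m n := by
  set k : ℤ := 2 * n - m with hk
  have hindex : 2 * (m : ℤ) - n = -k + (m + n : ℕ) := by push_cast [hk]; ring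
  have hne (i : ℕ) : 1 - s + (-k : ℤ) + i ≠ 0 := fun h =>
    Complex.integerComplement_add_ne_zero hs (k - 1 - i) (by
      push_cast at h ⊢; linear_combination -h)
  have harg : 1 - s + (-k : ℤ) = -(s - 1 + 2 * n - m) := by push_cast [hk]; ring
  have hsign : (-1 : ℂ) ^ k * (-1) ^ (m + n) = (-1) ^ n := by
    rw [← zpow_natCast, ← zpow_natCast (-1 : ℂ) n, ← zpow_add₀ (by norm_num), hk,
      show 2 * (n : ℤ) - m + (m + n : ℕ) = 2 * n + n by push_cast; ring,
      zpow_add₀ (by norm_num), zpow_mul]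
    norm_num
  rw [hornG3Coeff, hornG3PolyCoeff, hindex, intPochhammer_add_natCast fun i _ => hne i, ← mul_assoc,
    intPochhammer_mul_intPochhammer_one_sub_neg hs, harg, ascPochhammer_eval_neg_eq_descPochhammer,
    ← mul_assoc, hsign]

theorem eventually_mem_integerComplement (r : ℂ) :
    ∀ᶠ s in 𝓝[≠] r, s ∈ Complex.integerComplement :=
  disjoint_principal_right.1 (isClosed_and_discrete_iff.1
    ⟨Complex.isClosedEmbedding_intCast.isClosed_range,
      Complex.isClosedEmbedding_intCast.isEmbedding.isInducing.isDiscrete_range⟩ r)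

theorem tendsto_hornG3Coeff (r : ℂ) (m n : ℕ) :
    Tendsto (fun s : ℂ => hornG3Coeff s (1 - s) m n) (𝓝[≠] r) (𝓝 (hornG3PolyCoeff r m n)) := by
  refine ((continuous_hornG3PolyCoeff m n).tendsto r |>.mono_left nhdsWithin_le_nhds).congr' ?_
  filter_upwards [eventually_mem_integerComplement r] with s hs
  exact (hornG3Coeff_eq_hornG3PolyCoeff hs m n).symm

theorem hornG3DiagCoeff_eq_hornG3PolyCoeff (r : ℂ) (m n : ℕ) :
    hornG3DiagCoeff r m n = hornG3PolyCoeff r m n :=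
  (tendsto_hornG3Coeff r m n).limUnder_eq

theorem sum_antidiagonal_choose_mul_pow_mul_pow {R : Type*} [CommSemiring R] (a b : R) (N : ℕ) :
    ∑ k ∈ Finset.HasAntidiagonal.antidiagonal N,
      ((k.1 + k.2).choose k.1 : R) * a ^ k.1 * b ^ k.2 = (a + b) ^ N := by
  rw [(Commute.all a b).add_pow']
  refine Finset.sum_congr rfl fun k hk => ?_
  rw [Finset.HasAntidiagonal.mem_antidiagonal.1 hk, nsmul_eq_mul, mul_assoc]

theorem summable_choose_mul_pow_mul_pow {a b : ℝ} (ha : 0 ≤ a) (hb : 0 ≤ b) (hab : a + b < 1) :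
    Summable fun k : ℕ × ℕ => ((k.1 + k.2).choose k.1 : ℝ) * a ^ k.1 * b ^ k.2 := by
  rw [← Finset.HasAntidiagonal.sigmaAntidiagonalEquivProd.summable_iff,
    summable_sigma_of_nonneg fun k => by simp only [Function.comp]; positivity]
  refine ⟨fun N => .of_finite, ?_⟩
  convert summable_geometric_of_lt_one (add_nonneg ha hb) hab with N
  rw [← sum_antidiagonal_choose_mul_pow_mul_pow, tsum_fintype]
  exact Finset.sum_coe_sort _ fun k : ℕ × ℕ => ((k.1 + k.2).choose k.1 : ℝ) * a ^ k.1 * b ^ k.2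

theorem hasSum_choose_mul_pow_mul_pow {𝕜 : Type*} [NormedField 𝕜] [CompleteSpace 𝕜] {A B : 𝕜}
    (hAB : ‖A‖ + ‖B‖ < 1) :
    HasSum (fun k : ℕ × ℕ => ((k.1 + k.2).choose k.1 : 𝕜) * A ^ k.1 * B ^ k.2)
      (1 - A - B)⁻¹ := by
  have hsum : Summable fun k : ℕ × ℕ => ((k.1 + k.2).choose k.1 : 𝕜) * A ^ k.1 * B ^ k.2 := by
    refine .of_norm_bounded
      (summable_choose_mul_pow_mul_pow (norm_nonneg A) (norm_nonneg B) hAB) fun k => ?_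
    rw [norm_mul, norm_mul, norm_pow, norm_pow]
    gcongr
    simpa using Nat.norm_cast_le (α := 𝕜) ((k.1 + k.2).choose k.1)
  have hgeom : HasSum (fun N : ℕ => (A + B) ^ N) (1 - A - B)⁻¹ := by
    rw [sub_sub]
    exact hasSum_geometric_of_norm_lt_one ((norm_add_le A B).trans_lt hAB)
  have hfiber (N : ℕ) : HasSum (fun k : Finset.HasAntidiagonal.antidiagonal N =>
      ((k.1.1 + k.1.2).choose k.1.1 : 𝕜) * A ^ k.1.1 * B ^ k.1.2) ((A + B) ^ N) := by
    rw [← sum_antidiagonal_choose_mul_pow_mul_pow]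
    exact Finset.hasSum _ _
  have hsigma := Finset.HasAntidiagonal.sigmaAntidiagonalEquivProd.hasSum_iff.2 hsum.hasSum
  rw [hgeom.unique (hsigma.sigma hfiber)]
  exact hsum.hasSum

/-! ### Lagrange inversion in two perturbations -/

section ContourIntegral

variable {E : Type*} [NormedAddCommGroup E] [NormedSpace ℂ E] {c w : ℂ} {R : ℝ}

theorem hasSum_circleIntegral_of_summable_norm {ι : Type*} [Countable ι] (hR : 0 ≤ R)
    {F : ι → ℂ → E} {G : ℂ → E} {u : ι → ℝ} (hu : Summable u)
    (hF : ∀ i, ContinuousOn (F i) (Metric.sphere c R))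
    (hFu : ∀ i, ∀ z ∈ Metric.sphere c R, ‖F i z‖ ≤ u i)
    (hG : ∀ z ∈ Metric.sphere c R, HasSum (fun i => F i z) (G z)) :
    HasSum (fun i => ∮ z in C(c, R), F i z) (∮ z in C(c, R), G z) := by
  have hmem (θ : ℝ) := circleMap_mem_sphere c hR θ
  refine intervalIntegral.hasSum_integral_of_dominated_convergence (fun i _ => R * u i)
    (fun i => ?_) (fun i => .of_forall fun θ _ => ?_) (.of_forall fun θ _ => hu.mul_left R)
    intervalIntegrable_const (.of_forall fun θ _ => (hG _ (hmem θ)).const_smul _)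
  · refine Continuous.aestronglyMeasurable ?_
    simp only [deriv_circleMap]
    exact ((continuous_circleMap _ _).mul continuous_const).smul
      ((hF i).comp_continuous (continuous_circleMap c R) hmem)
  · simpa [norm_smul, abs_of_nonneg hR] using mul_le_mul_of_nonneg_left (hFu i _ (hmem θ)) hR

variable {φ ψ : ℂ → ℂ} {h : ℂ → E} {a b : ℝ}

theorem hasSum_circleIntegral_choose_mul_pow_mul_pow_smul (hR : 0 ≤ R)
    (hφ : ContinuousOn φ (Metric.sphere c R)) (hψ : ContinuousOn ψ (Metric.sphere c R))
    (hh : ContinuousOn h (Metric.sphere c R)) (ha : ∀ z ∈ Metric.sphere c R, ‖φ z‖ ≤ a)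
    (hb : ∀ z ∈ Metric.sphere c R, ‖ψ z‖ ≤ b) (hab : a + b < 1) :
    HasSum
      (fun k : ℕ × ℕ => ∮ z in C(c, R),
        ((k.1 + k.2).choose k.1 * φ z ^ k.1 * ψ z ^ k.2 : ℂ) • h z)
      (∮ z in C(c, R), (1 - φ z - ψ z)⁻¹ • h z) := by
  obtain ⟨C, hC⟩ := (isCompact_sphere c R).exists_bound_of_continuousOn hh
  obtain ⟨z₀, hz₀⟩ : (Metric.sphere c R).Nonempty := NormedSpace.sphere_nonempty.2 hR
  have ha₀ : 0 ≤ a := (norm_nonneg _).trans (ha z₀ hz₀)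
  have hb₀ : 0 ≤ b := (norm_nonneg _).trans (hb z₀ hz₀)
  refine hasSum_circleIntegral_of_summable_norm hR
    ((summable_choose_mul_pow_mul_pow ha₀ hb₀ hab).mul_right C) (fun k => by fun_prop)
    (fun k z hz => ?_) fun z hz => (hasSum_choose_mul_pow_mul_pow
      ((add_le_add (ha z hz) (hb z hz)).trans_lt hab)).smul_const (h z)
  rw [norm_smul, norm_mul, norm_mul, norm_pow, norm_pow, Complex.norm_natCast]
  gcongr
  exacts [ha z hz, hb z hz, hC z hz]

theorem hasSum_circleIntegral_sub_sub_inv_smul (hR : 0 < R)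
    (hφ : ContinuousOn φ (Metric.sphere c R)) (hψ : ContinuousOn ψ (Metric.sphere c R))
    (hh : ContinuousOn h (Metric.sphere c R)) (ha : ∀ z ∈ Metric.sphere c R, ‖φ z‖ ≤ a)
    (hb : ∀ z ∈ Metric.sphere c R, ‖ψ z‖ ≤ b) (hab : a + b < R) :
    HasSum
      (fun k : ℕ × ℕ => ∮ z in C(c, R), ((k.1 + k.2).choose k.1 : ℂ) •
        (1 / (z - c) ^ (k.1 + k.2 + 1)) • (φ z ^ k.1 * ψ z ^ k.2) • h z)
      (∮ z in C(c, R), (z - c - φ z - ψ z)⁻¹ • h z) := by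
  have hne : ∀ z ∈ Metric.sphere c R, z - c ≠ 0 := fun z hz =>
    sub_ne_zero.2 (Metric.ne_of_mem_sphere hz hR.ne')
  have hsub : ContinuousOn (fun z => z - c) (Metric.sphere c R) := by fun_prop
  have hbound {χ : ℂ → ℂ} {e : ℝ} (he : ∀ z ∈ Metric.sphere c R, ‖χ z‖ ≤ e) :
      ∀ z ∈ Metric.sphere c R, ‖χ z / (z - c)‖ ≤ e / R := fun z hz => by
    rw [norm_div, mem_sphere_iff_norm.1 hz]
    gcongr
    exact he z hz
  have hterm (k : ℕ × ℕ) (z : ℂ) : ((k.1 + k.2).choose k.1 : ℂ) •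
      (1 / (z - c) ^ (k.1 + k.2 + 1)) • (φ z ^ k.1 * ψ z ^ k.2) • h z =
      ((k.1 + k.2).choose k.1 * (φ z / (z - c)) ^ k.1 * (ψ z / (z - c)) ^ k.2 : ℂ) •
        (z - c)⁻¹ • h z := by
    simp only [smul_smul]
    congr 1
    simp only [div_eq_mul_inv, mul_pow, pow_add, mul_inv, pow_one, one_mul, inv_pow]
    ring
  simp only [hterm]
  have hkernel : ∮ z in C(c, R), (z - c - φ z - ψ z)⁻¹ • h z =
      ∮ z in C(c, R), (1 - φ z / (z - c) - ψ z / (z - c))⁻¹ • (z - c)⁻¹ • h z := by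
    refine circleIntegral.integral_congr hR.le fun z hz => ?_
    have hz₀ := hne z hz
    simp only [smul_smul, ← mul_inv, sub_mul, one_mul, div_mul_cancel₀ _ hz₀]
  rw [hkernel]
  exact hasSum_circleIntegral_choose_mul_pow_mul_pow_smul hR.le (hφ.div hsub hne)
    (hψ.div hsub hne) ((hsub.inv₀ hne).smul hh) (hbound ha) (hbound hb)
    (by rwa [← add_div, div_lt_one hR])

variable [CompleteSpace E]

theorem circleIntegral_inv_smul_of_simple_zero {g : ℂ → ℂ}
    (hg : DifferentiableOn ℂ g (Metric.closedBall c R))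
    (hh : DifferentiableOn ℂ h (Metric.closedBall c R)) (hw : w ∈ Metric.ball c R)
    (hzero : ∀ z ∈ Metric.closedBall c R, g z = 0 ↔ z = w) (hderiv : deriv g w ≠ 0) :
    ∮ z in C(c, R), (g z)⁻¹ • h z = (2 * Real.pi * Complex.I : ℂ) • (deriv g w)⁻¹ • h w := by
  have hwc := Metric.ball_subset_closedBall hw
  have hgw : g w = 0 := (hzero w hwc).2 rfl
  have hfactor (z : ℂ) : (z - w) * dslope g w z = g z := by
    simpa [hgw] using sub_smul_dslope g w z
  have hslope : ∀ z ∈ Metric.closedBall c R, dslope g w z ≠ 0 := by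
    intro z hz h0
    obtain rfl := (hzero z hz).1 (by rw [← hfactor, h0, mul_zero])
    exact hderiv (by rwa [dslope_same] at h0)
  have hdslope : DifferentiableOn ℂ (dslope g w) (Metric.closedBall c R) :=
    (Complex.differentiableOn_dslope (Metric.closedBall_mem_nhds_of_mem hw)).2 hg
  have hcauchy := ((hdslope.inv hslope).smul hh).circleIntegral_sub_inv_smul hw
  rw [Pi.smul_apply', Pi.inv_apply, dslope_same] at hcauchy
  rw [← hcauchy]
  refine circleIntegral.integral_congr (Metric.pos_of_mem_ball hw).le fun z _ => ?_
  simp only [← hfactor z, mul_inv, mul_smul, Pi.smul_apply', Pi.inv_apply]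

-- The contour integral of `h z / (z - c - φ z - ψ z)` is a residue at the root `w`; expanding the
-- kernel in powers of `φ z / (z - c)` and `ψ z / (z - c)` turns it into Cauchy's formulas for the
-- derivatives at `c`.
theorem hasSum_iteratedDeriv_of_simple_root
    (hφ : DifferentiableOn ℂ φ (Metric.closedBall c R))
    (hψ : DifferentiableOn ℂ ψ (Metric.closedBall c R))
    (hh : DifferentiableOn ℂ h (Metric.closedBall c R))
    (ha : ∀ z ∈ Metric.sphere c R, ‖φ z‖ ≤ a) (hb : ∀ z ∈ Metric.sphere c R, ‖ψ z‖ ≤ b)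
    (hab : a + b < R) (hw : w ∈ Metric.ball c R)
    (hroot : ∀ z ∈ Metric.closedBall c R, z = c + φ z + ψ z ↔ z = w)
    (hderiv : deriv φ w + deriv ψ w ≠ 1) :
    HasSum
      (fun k : ℕ × ℕ => (k.1.factorial * k.2.factorial : ℂ)⁻¹ •
        iteratedDeriv (k.1 + k.2) (fun z => (φ z ^ k.1 * ψ z ^ k.2) • h z) c)
      ((1 - deriv φ w - deriv ψ w)⁻¹ • h w) := by
  have hR := Metric.pos_of_mem_ball hw
  have hsphere := Metric.sphere_subset_closedBall (x := c) (ε := R)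
  have hnhds := Metric.closedBall_mem_nhds_of_mem hw
  have hsum := hasSum_circleIntegral_sub_sub_inv_smul hR (hφ.continuousOn.mono hsphere)
    (hψ.continuousOn.mono hsphere) (hh.continuousOn.mono hsphere) ha hb hab
  have hderiv' : HasDerivAt (fun z => z - c - φ z - ψ z) (1 - deriv φ w - deriv ψ w) w :=
    (((hasDerivAt_id w).sub_const c).sub (hφ.differentiableAt hnhds).hasDerivAt).sub
      (hψ.differentiableAt hnhds).hasDerivAt
  have hne : 1 - deriv φ w - deriv ψ w ≠ 0 := by
    rw [sub_sub, sub_ne_zero]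
    exact hderiv.symm
  rw [circleIntegral_inv_smul_of_simple_zero (by fun_prop) hh hw (fun z hz => by
    rw [← hroot z hz, sub_sub, sub_sub, sub_eq_zero, add_assoc]) (hderiv'.deriv ▸ hne),
    hderiv'.deriv] at hsum
  convert hsum.const_smul (2 * Real.pi * Complex.I : ℂ)⁻¹ using 1
  · ext k
    have hk : DifferentiableOn ℂ (fun z => (φ z ^ k.1 * ψ z ^ k.2) • h z)
        (Metric.closedBall c R) := ((hφ.pow _).mul (hψ.pow _)).smul hh
    simp only [circleIntegral.integral_smul]
    rw [hk.circleIntegral_one_div_sub_center_pow_smul hR]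
    simp only [smul_smul]
    congr 1
    have hfac : ((k.1 + k.2).factorial : ℂ) ≠ 0 := by exact_mod_cast Nat.factorial_ne_zero _
    rw [Nat.cast_add_choose, eq_inv_mul_iff_mul_eq₀ Complex.two_pi_I_ne_zero]
    field_simp
  · rw [inv_smul_smul₀ Complex.two_pi_I_ne_zero]

end ContourIntegral

theorem iteratedDeriv_cpow_const (α : ℂ) (N : ℕ) {z : ℂ} (hz : z ∈ Complex.slitPlane) :
    iteratedDeriv N (fun z : ℂ => z ^ α) z = (descPochhammer ℂ N).eval α * z ^ (α - N) := by
  induction N generalizing z with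
  | zero => simp
  | succ N ih =>
    have hN : iteratedDeriv N (fun z : ℂ => z ^ α) =ᶠ[𝓝 z]
        fun z => (descPochhammer ℂ N).eval α * z ^ (α - N) :=
      eventually_of_mem (Complex.isOpen_slitPlane.mem_nhds hz) fun _ => ih
    rw [iteratedDeriv_succ, hN.deriv_eq,
      (((hasDerivAt_id' z).cpow_const (c := α - N) hz).const_mul _).deriv, descPochhammer_succ_eval]
    simp only [Nat.cast_succ, mul_one, sub_sub, mul_assoc]

theorem iteratedDeriv_lagrange_eq_hornG3DiagTerm (r x y : ℂ) (k : ℕ × ℕ) :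
    (k.1.factorial * k.2.factorial : ℂ)⁻¹ • iteratedDeriv (k.1 + k.2)
      (fun z : ℂ => ((x / z) ^ k.1 * (-y * z ^ 2) ^ k.2) • z ^ (r - 1)) 1 =
      hornG3DiagTerm r x y k := by
  have hmonomial : (fun z : ℂ => ((x / z) ^ k.1 * (-y * z ^ 2) ^ k.2) • z ^ (r - 1)) =ᶠ[𝓝 1]
      fun z => x ^ k.1 * (-y) ^ k.2 * z ^ (r - 1 + 2 * k.2 - k.1) := by
    filter_upwards [Complex.isOpen_slitPlane.mem_nhds Complex.one_mem_slitPlane] with z hz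
    have hz₀ := Complex.slitPlane_ne_zero hz
    have hpow : z ^ (2 * k.2 : ℂ) = z ^ (2 * k.2) := by
      exact_mod_cast Complex.cpow_natCast z (2 * k.2)
    rw [Complex.cpow_sub (r - 1 + 2 * k.2) _ hz₀, Complex.cpow_add _ _ hz₀, Complex.cpow_natCast,
      hpow, smul_eq_mul, div_pow, mul_pow, pow_mul]
    ring
  rw [hmonomial.iteratedDeriv_eq, iteratedDeriv_const_mul_field,
    iteratedDeriv_cpow_const _ _ Complex.one_mem_slitPlane, Complex.one_cpow, hornG3DiagTerm,
    hornG3DiagCoeff_eq_hornG3PolyCoeff, hornG3PolyCoeff, neg_pow y, smul_eq_mul]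
  ring

/-- The derivative of `y w³ + w² - w - x` with respect to `w`, the common denominator of the
generating functions `G₃(r, 1 - r | x, y)`. -/
def g3CubicDeriv (y w : ℂ) : ℂ := 3 * y * w ^ 2 + 2 * w - 1

theorem norm_sub_le_norm_of_mem_closedBall {E : Type*} [SeminormedAddCommGroup E] {a b : E}
    {r : ℝ} (hb : b ∈ Metric.closedBall a r) : ‖a‖ - r ≤ ‖b‖ := by
  linarith [norm_sub_norm_le a b, mem_closedBall_iff_norm'.1 hb]

theorem cubic_eq_zero_iff_eq {x y w z : ℂ} (hy : ‖y‖ < 1 / 40) (hw : ‖w - 1‖ < 1 / 4)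
    (hroot : y * w ^ 3 + w ^ 2 - w - x = 0) (hz : z ∈ Metric.closedBall (1 : ℂ) (1 / 2)) :
    y * z ^ 3 + z ^ 2 - z - x = 0 ↔ z = w := by
  refine ⟨fun hroot' => by_contra fun hne => ?_, fun h => h ▸ hroot⟩
  -- Dividing out `z - w` would force a second root to lie near `0`, the other root at `x = y = 0`.
  have hquot : z = -(y * (z ^ 2 + w * z + w ^ 2) + (w - 1)) := by
    have : (z - w) * (z + (y * (z ^ 2 + w * z + w ^ 2) + (w - 1))) = 0 := by
      linear_combination hroot' - hroot
    exact eq_neg_of_add_eq_zero_left ((mul_eq_zero.1 this).resolve_left (sub_ne_zero.2 hne))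
  have hwn : ‖w‖ ≤ 3 / 2 :=
    (norm_le_of_mem_closedBall (mem_closedBall_iff_norm.2 hw.le)).trans (by norm_num)
  have hzn : ‖z‖ ≤ 3 / 2 := (norm_le_of_mem_closedBall hz).trans (by norm_num)
  have hquad : ‖z ^ 2 + w * z + w ^ 2‖ ≤ 27 / 4 := by
    refine (norm_add₃_le).trans ?_
    rw [norm_pow, norm_mul, norm_pow]
    nlinarith [norm_nonneg z, norm_nonneg w]
  have : ‖z‖ < 1 / 2 := calc
    ‖z‖ ≤ ‖y‖ * ‖z ^ 2 + w * z + w ^ 2‖ + ‖w - 1‖ := by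
      conv_lhs => rw [hquot, norm_neg]
      exact (norm_add_le _ _).trans_eq (by rw [norm_mul])
    _ ≤ 1 / 40 * (27 / 4) + ‖w - 1‖ := by gcongr
    _ < 1 / 2 := by linarith
  exact this.not_ge (by linarith [norm_sub_le_norm_of_mem_closedBall hz, norm_one (α := ℂ)])

theorem g3CubicDeriv_ne_zero {y w : ℂ} (hy : ‖y‖ < 1 / 40) (hw : ‖w - 1‖ < 1 / 4) :
    g3CubicDeriv y w ≠ 0 := fun h₀ => by
  have hwn : ‖w‖ ≤ 5 / 4 :=
    (norm_le_of_mem_closedBall (mem_closedBall_iff_norm.2 hw.le)).trans (by norm_num)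
  have hone : 1 = -(3 * y * w ^ 2 + 2 * (w - 1)) := by
    rw [g3CubicDeriv] at h₀
    linear_combination h₀
  have : ‖(1 : ℂ)‖ < 1 := calc
    ‖(1 : ℂ)‖ ≤ 3 * ‖y‖ * ‖w‖ ^ 2 + 2 * ‖w - 1‖ := by
      conv_lhs => rw [hone, norm_neg]
      exact (norm_add_le _ _).trans_eq (by simp)
    _ ≤ 3 * (1 / 40) * (5 / 4) ^ 2 + 2 * (1 / 4) := by gcongr
    _ < 1 := by norm_num
  exact this.ne norm_one

theorem eq_one_add_div_add_iff_cubic_eq_zero {x y z : ℂ} (hz : z ≠ 0) :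
    z = 1 + x / z + -y * z ^ 2 ↔ y * z ^ 3 + z ^ 2 - z - x = 0 := by
  have : z - (1 + x / z + -y * z ^ 2) = (y * z ^ 3 + z ^ 2 - z - x) / z := by
    field_simp
    ring
  rw [← sub_eq_zero, this, div_eq_zero_iff, or_iff_left hz]

theorem one_sub_deriv_sub_deriv_eq_g3CubicDeriv_div {x y w : ℂ} (hw₀ : w ≠ 0)
    (hroot : y * w ^ 3 + w ^ 2 - w - x = 0) :
    1 - deriv (fun z : ℂ => x / z) w - deriv (fun z : ℂ => -y * z ^ 2) w =
      g3CubicDeriv y w / w := by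
  have hφ' : HasDerivAt (fun z : ℂ => x / z) (-x / w ^ 2) w := by
    simpa using (hasDerivAt_const w x).fun_div (hasDerivAt_id' w) hw₀
  have hψ' : HasDerivAt (fun z : ℂ => -y * z ^ 2) (-y * (2 * w)) w := by
    simpa using (hasDerivAt_pow 2 w).const_mul (-y)
  rw [hφ'.deriv, hψ'.deriv, g3CubicDeriv]
  field_simp
  linear_combination -hroot

theorem hasSum_hornG3DiagTerm_of_root {x y w : ℂ} (hx : ‖x‖ < 1 / 40) (hy : ‖y‖ < 1 / 40)
    (hw : ‖w - 1‖ < 1 / 4) (hroot : y * w ^ 3 + w ^ 2 - w - x = 0) (r : ℂ) :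
    HasSum (hornG3DiagTerm r x y) (w ^ r / g3CubicDeriv y w) := by
  have hslit : Metric.closedBall (1 : ℂ) (1 / 2) ⊆ Complex.slitPlane :=
    (Metric.closedBall_subset_ball (by norm_num)).trans Complex.ball_one_subset_slitPlane
  have hne {z : ℂ} (hz : z ∈ Metric.closedBall (1 : ℂ) (1 / 2)) : z ≠ 0 :=
    Complex.slitPlane_ne_zero (hslit hz)
  have hwb : w ∈ Metric.ball (1 : ℂ) (1 / 2) := mem_ball_iff_norm.2 (hw.trans (by norm_num))
  have hw₀ := hne (Metric.ball_subset_closedBall hwb)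
  have hderiv := one_sub_deriv_sub_deriv_eq_g3CubicDeriv_div hw₀ hroot
  have hcubicDeriv := g3CubicDeriv_ne_zero hy hw
  have hlagrange := hasSum_iteratedDeriv_of_simple_root (c := 1) (R := 1 / 2) (w := w)
    (φ := fun z => x / z) (ψ := fun z => -y * z ^ 2) (h := fun z => z ^ (r - 1))
    -- `|x / z| ≤ (1 / 40) / (1 / 2)` and `|y z ^ 2| ≤ (1 / 40) (3 / 2) ^ 2` on the circle
    (a := 1 / 20) (b := 9 / 160)
    ((differentiableOn_const x).fun_div differentiableOn_id fun _ => hne)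
    (by fun_prop) (fun z hz => (differentiableAt_id.cpow_const (hslit hz)).differentiableWithinAt)
    (fun z hz => ?_) (fun z hz => ?_) (by norm_num) hwb (fun z hz => ?_) ?_
  · simp only [iteratedDeriv_lagrange_eq_hornG3DiagTerm] at hlagrange
    simp only [hderiv, inv_div, smul_eq_mul,
      Complex.cpow_sub _ _ hw₀, Complex.cpow_one] at hlagrange
    rwa [mul_comm, div_mul_div_cancel₀ hw₀] at hlagrange
  · have := norm_sub_le_norm_of_mem_closedBall (Metric.sphere_subset_closedBall hz)
    rw [norm_one] at this
    rw [norm_div, div_le_iff₀ (by linarith)]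
    linarith
  · have : ‖z‖ ≤ 3 / 2 := (norm_le_of_mem_closedBall (Metric.sphere_subset_closedBall hz)).trans
      (by norm_num)
    calc ‖-y * z ^ 2‖ = ‖y‖ * ‖z‖ ^ 2 := by simp
      _ ≤ 1 / 40 * (3 / 2) ^ 2 := by gcongr
      _ = 9 / 160 := by norm_num
  · rw [eq_one_add_div_add_iff_cubic_eq_zero (hne hz), cubic_eq_zero_iff_eq hy hw hroot hz]
  · rw [ne_comm, ← sub_ne_zero, ← sub_sub, hderiv]
    exact div_ne_zero hcubicDeriv hw₀

/-! ### Identity theorem along complex lines -/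

section LineDifferentiable

variable {E H : Type*} [NormedAddCommGroup E] [NormedSpace ℂ E] [NormedAddCommGroup H]
  [NormedSpace ℂ H]

theorem differentiableAt_add_smul_of_lineDifferentiableAt {F : E → H} {q v : E} {t : ℂ}
    (hF : LineDifferentiableAt ℂ F (q + t • v) v) :
    DifferentiableAt ℂ (fun u : ℂ => F (q + u • v)) t := by
  have hshift : DifferentiableAt ℂ (fun u : ℂ => u - t) t := by fun_prop
  have hcomp := DifferentiableAt.comp t (by rwa [sub_self]) hshift
  refine hcomp.congr_of_eventuallyEq (.of_forall fun u => ?_)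
  simp only [Function.comp, add_assoc, ← add_smul, add_sub_cancel]

variable [CompleteSpace H] {F G : E → H} {U : Set E} {p₀ : E}

theorem eqOn_of_lineDifferentiableAt_of_convex [Module ℝ E] [IsScalarTower ℝ ℂ E]
    (hU : IsOpen U) (hconv : Convex ℝ U)
    (hF : ∀ p ∈ U, ∀ v, LineDifferentiableAt ℂ F p v)
    (hG : ∀ p ∈ U, ∀ v, LineDifferentiableAt ℂ G p v) (hp₀ : p₀ ∈ U) (heq : F =ᶠ[𝓝 p₀] G) :
    Set.EqOn F G U := by
  intro p hp
  have hline : Continuous fun t : ℂ => p₀ + t • (p - p₀) := by fun_prop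
  set V : Set ℂ := (fun t : ℂ => p₀ + t • (p - p₀)) ⁻¹' U with hV
  have hVconv : Convex ℝ V := (hconv.translate_preimage_right p₀).linear_preimage
    ((LinearMap.toSpanSingleton ℂ E (p - p₀)).restrictScalars ℝ)
  have hanalytic {K : E → H} (hK : ∀ q ∈ U, ∀ v, LineDifferentiableAt ℂ K q v) :
      AnalyticOnNhd ℂ (fun t : ℂ => K (p₀ + t • (p - p₀))) V :=
    DifferentiableOn.analyticOnNhd (fun t ht => (differentiableAt_add_smul_of_lineDifferentiableAt
      (hK _ ht (p - p₀))).differentiableWithinAt) (hU.preimage hline)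
  have hnear : (fun t : ℂ => F (p₀ + t • (p - p₀))) =ᶠ[𝓝 0] fun t => G (p₀ + t • (p - p₀)) :=
    (show Tendsto _ _ (𝓝 p₀) by simpa using hline.tendsto 0).eventually heq
  have heqOn := (hanalytic hF).eqOn_of_preconnected_of_eventuallyEq (hanalytic hG)
    hVconv.isPreconnected (by simpa [hV] using hp₀) hnear
  simpa using heqOn (show (1 : ℂ) ∈ V by simpa [hV] using hp)

theorem eqOn_of_lineDifferentiableAt_of_isPreconnected (hU : IsOpen U) (hc : IsPreconnected U)
    (hF : ∀ p ∈ U, ∀ v, LineDifferentiableAt ℂ F p v)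
    (hG : ∀ p ∈ U, ∀ v, LineDifferentiableAt ℂ G p v) (hp₀ : p₀ ∈ U) (heq : F =ᶠ[𝓝 p₀] G) :
    Set.EqOn F G U := by
  let : NormedSpace ℝ E := .restrictScalars ℝ ℂ E
  suffices U ⊆ {p | F =ᶠ[𝓝 p] G} from fun p hp => (this hp).self_of_nhds
  refine hc.subset_of_closure_inter_subset isOpen_setOfPred_eventually_nhds ⟨p₀, hp₀, heq⟩ ?_
  rintro p ⟨hpc, hpU⟩
  obtain ⟨ε, hε, hball⟩ := Metric.isOpen_iff.1 hU p hpU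
  obtain ⟨q, hq, hqp⟩ := Metric.mem_closure_iff.1 hpc ε hε
  rw [dist_comm] at hqp
  exact (eqOn_of_lineDifferentiableAt_of_convex Metric.isOpen_ball (convex_ball p ε)
    (fun p hp => hF p (hball hp)) (fun p hp => hG p (hball hp)) hqp hq).eventuallyEq_of_mem
    (Metric.ball_mem_nhds p hε)

end LineDifferentiable

theorem exists_norm_lt_of_mem_nhds {E : Type*} [NormedAddCommGroup E] [NormedSpace ℝ E]
    [Nontrivial E] {a : E} {V : Set E} (hV : V ∈ 𝓝 a) : ∃ z ∈ V, ‖a‖ < ‖z‖ := by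
  by_contra! h
  have hint : a ∈ interior (Metric.closedBall (0 : E) ‖a‖) :=
    mem_interior_iff_mem_nhds.2 (mem_of_superset hV fun z hz => mem_closedBall_zero_iff.2 (h z hz))
  rw [interior_closedBall'] at hint
  simp at hint

-- As in Abel's lemma, absolute convergence at a point `(a, b)` of `U` with `|a| > |p.1|` and
-- `|b| > |p.2|` dominates the series near `p`.
theorem lineDifferentiableAt_tsum_mul_pow_mul_pow {c : ℕ × ℕ → ℂ} {U : Set (ℂ × ℂ)}
    (hU : IsOpen U) (hsum : ∀ p ∈ U, Summable fun k : ℕ × ℕ => c k * p.1 ^ k.1 * p.2 ^ k.2)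
    {p : ℂ × ℂ} (hp : p ∈ U) (v : ℂ × ℂ) :
    LineDifferentiableAt ℂ (fun p => ∑' k, c k * p.1 ^ k.1 * p.2 ^ k.2) p v := by
  obtain ⟨V, hV, W, hW, hVW⟩ := mem_nhds_prod_iff.1 (hU.mem_nhds hp)
  obtain ⟨a, ha, hpa⟩ := exists_norm_lt_of_mem_nhds hV
  obtain ⟨b, hb, hpb⟩ := exists_norm_lt_of_mem_nhds hW
  set T : Set ℂ := {t | ‖(p + t • v).1‖ < ‖a‖} ∩ {t | ‖(p + t • v).2‖ < ‖b‖}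
  have hT : IsOpen T :=
    (isOpen_lt (by fun_prop) continuous_const).inter (isOpen_lt (by fun_prop) continuous_const)
  refine (Complex.differentiableOn_tsum_of_summable_norm (hsum (a, b) (hVW ⟨ha, hb⟩)).norm
    (fun k => ?_) hT fun k t ht => ?_).differentiableAt
    (hT.mem_nhds ⟨by simpa using hpa, by simpa using hpb⟩)
  · fun_prop
  · simp only [norm_mul, norm_pow]
    gcongr
    exacts [ht.1.le, ht.2.le]

/-! ### The algebraic function -/

theorem g3G_mul_g3CubicDeriv_sq {x y w : ℂ} (hroot : y * w ^ 3 + w ^ 2 - w - x = 0) :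
    g3G y w * g3CubicDeriv y w ^ 2 = g3Delta x y := by
  obtain rfl : x = y * w ^ 3 + w ^ 2 - w := by linear_combination -hroot
  unfold g3G g3CubicDeriv g3Delta
  ring

theorem g3G_div_g3Delta_eq_inv_g3CubicDeriv_sq {x y w : ℂ}
    (hroot : y * w ^ 3 + w ^ 2 - w - x = 0) (hΔ : g3Delta x y ≠ 0) :
    g3G y w / g3Delta x y = (g3CubicDeriv y w)⁻¹ ^ 2 := by
  rw [← g3G_mul_g3CubicDeriv_sq hroot] at hΔ ⊢
  rw [inv_pow, div_mul_cancel_left₀ (left_ne_zero_of_mul hΔ)]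

theorem exists_g3Root_near_zero :
    ∃ f : ℂ × ℂ → ℂ, f (0, 0) = 1 ∧ ∀ᶠ p : ℂ × ℂ in 𝓝 (0, 0),
      DifferentiableAt ℂ f p ∧ p.2 * f p ^ 3 + f p ^ 2 - f p - p.1 = 0 := by
  set P : (ℂ × ℂ) × ℂ → ℂ := fun q => q.1.2 * q.2 ^ 3 + q.2 ^ 2 - q.2 - q.1.1 with hP
  have hcont : ContDiffAt ℂ 1 P ((0, 0), 1) := by
    have : ContDiff ℂ 1 P := by fun_prop
    exact this.contDiffAt
  have hpartial : (fderiv ℂ P ((0, 0), 1) ∘L .inr ℂ (ℂ × ℂ) ℂ) = .id ℂ ℂ := by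
    have hsection : HasDerivAt (fun w : ℂ => P ((0, 0), w)) 1 1 := by
      simp only [hP, zero_mul, zero_add, sub_zero]
      convert! ((hasDerivAt_pow 2 (1 : ℂ)).sub (hasDerivAt_id' 1)) using 1
      norm_num
    have hinr : HasDerivAt (fun w : ℂ => (((0, 0) : ℂ × ℂ), w)) (0, 1) 1 :=
      (hasDerivAt_const _ _).prodMk (hasDerivAt_id' _)
    have hchain := (hcont.differentiableAt one_ne_zero).hasFDerivAt.comp_hasDerivAt 1 hinr
    ext
    exact hchain.unique hsection
  have hinv : (fderiv ℂ P ((0, 0), 1) ∘L .inr ℂ (ℂ × ℂ) ℂ).IsInvertible :=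
    hpartial ▸ ⟨.refl ℂ ℂ, rfl⟩
  refine ⟨hcont.implicitFunction one_ne_zero hinv, hcont.implicitFunction_apply_self _ hinv, ?_⟩
  filter_upwards [(hcont.contDiffAt_implicitFunction one_ne_zero hinv).eventually (by simp),
    hcont.eventually_apply_implicitFunction one_ne_zero hinv] with p hdiff hroot
  exact ⟨hdiff.differentiableAt one_ne_zero, by simpa [hP] using hroot⟩

section NearOrigin

variable {f : ℂ × ℂ → ℂ}

theorem tendsto_g3Delta : Tendsto (fun p : ℂ × ℂ => g3Delta p.1 p.2) (𝓝 (0, 0)) (𝓝 1) := by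
  have : Continuous fun p : ℂ × ℂ => g3Delta p.1 p.2 := by unfold g3Delta; fun_prop
  simpa [g3Delta] using this.tendsto (0, 0)

theorem tendsto_inv_g3CubicDeriv (hf : ContinuousAt f (0, 0)) (hf₀ : f (0, 0) = 1) :
    Tendsto (fun p => (g3CubicDeriv p.2 (f p))⁻¹) (𝓝 (0, 0)) (𝓝 1) := by
  have hcont : ContinuousAt (fun p => g3CubicDeriv p.2 (f p)) (0, 0) := by
    unfold g3CubicDeriv
    fun_prop
  have hone : g3CubicDeriv 0 (f (0, 0)) = 1 := by norm_num [g3CubicDeriv, hf₀]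
  simpa [hone] using hcont.tendsto.inv₀ (by simp [hone])

theorem eventually_hasSum_hornG3DiagTerm (hf : ContinuousAt f (0, 0)) (hf₀ : f (0, 0) = 1)
    (hroot : ∀ᶠ p : ℂ × ℂ in 𝓝 (0, 0), p.2 * f p ^ 3 + f p ^ 2 - f p - p.1 = 0) :
    ∀ᶠ p : ℂ × ℂ in 𝓝 (0, 0), f p ∈ Complex.slitPlane ∧ g3Delta p.1 p.2 ≠ 0 ∧
      g3G p.2 (f p) / g3Delta p.1 p.2 ∈ Complex.slitPlane ∧
      ∀ r, HasSum (hornG3DiagTerm r p.1 p.2)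
        (f p ^ r * (g3G p.2 (f p) / g3Delta p.1 p.2) ^ (1 / 2 : ℂ)) := by
  have hslit := Complex.isOpen_slitPlane.mem_nhds Complex.one_mem_slitPlane
  have hre : ∀ᶠ z : ℂ in 𝓝 1, 0 < z.re :=
    (isOpen_lt continuous_const Complex.continuous_re).mem_nhds (by simp)
  have hinv := tendsto_inv_g3CubicDeriv hf hf₀
  have hinv_sq := hinv.pow 2
  rw [one_pow] at hinv_sq
  have hnear : ∀ᶠ p : ℂ × ℂ in 𝓝 (0, 0), p ∈ Metric.ball ((0, 0) : ℂ × ℂ) (1 / 40) :=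
    Metric.ball_mem_nhds _ (by norm_num)
  have hfnear : ∀ᶠ p in 𝓝 (0, 0), f p ∈ Metric.ball (1 : ℂ) (1 / 4) :=
    hf.eventually (hf₀ ▸ Metric.ball_mem_nhds _ (by norm_num))
  filter_upwards [hroot, hnear, hfnear, hf.eventually (hf₀ ▸ hslit), hinv_sq.eventually hslit,
    tendsto_g3Delta.eventually_ne one_ne_zero, hinv.eventually hre]
    with p hroot hp hfp hfslit hsqslit hΔ hinvre
  rw [← ball_prod_same] at hp
  rw [g3G_div_g3Delta_eq_inv_g3CubicDeriv_sq hroot hΔ]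
  refine ⟨hfslit, hΔ, hsqslit, fun r => ?_⟩
  rw [one_div, Complex.sq_cpow_two_inv hinvre, ← div_eq_mul_inv]
  exact hasSum_hornG3DiagTerm_of_root (mem_ball_zero_iff.1 hp.1) (mem_ball_zero_iff.1 hp.2)
    (mem_ball_iff_norm.1 hfp) hroot r

end NearOrigin

theorem exists_bidisc_hasSum_hornG3DiagTerm :
    ∃ ρ : ℝ, 0 < ρ ∧ ∃ f : ℂ × ℂ → ℂ,
      IsG3Root (Metric.ball 0 ρ ×ˢ Metric.ball 0 ρ) f ∧
      ∀ x y : ℂ, ‖x‖ < ρ → ‖y‖ < ρ →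
        f (x, y) ∈ Complex.slitPlane ∧ g3Delta x y ≠ 0 ∧
        g3G y (f (x, y)) / g3Delta x y ∈ Complex.slitPlane ∧
        ∀ r : ℂ, HasSum (hornG3DiagTerm r x y)
          (f (x, y) ^ r * (g3G y (f (x, y)) / g3Delta x y) ^ (1 / 2 : ℂ)) := by
  obtain ⟨f, hf₀, hf⟩ := exists_g3Root_near_zero
  have hsum := eventually_hasSum_hornG3DiagTerm hf.self_of_nhds.1.continuousAt hf₀
    (hf.mono fun _ => And.right)
  obtain ⟨ρ, hρ, h⟩ := Metric.eventually_nhds_iff_ball.1 (hf.and hsum)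
  rw [← ball_prod_same] at h
  exact ⟨ρ, hρ, f, ⟨fun p hp => (h p hp).1.1.differentiableWithinAt, fun p hp => (h p hp).1.2, hf₀⟩,
    fun x y hx hy => (h (x, y) ⟨mem_ball_zero_iff.2 hx, mem_ball_zero_iff.2 hy⟩).2⟩

section Branches

variable {l s : ℂ × ℂ → ℂ}

theorem eventually_tsum_hornG3DiagTerm_eq_of_branches (r : ℂ) (hl : ContinuousAt l (0, 0))
    (hs : ContinuousAt s (0, 0)) (hl₀ : l (0, 0) = 0) (hs₀ : s (0, 0) = 1)
    (hroot : ∀ᶠ p : ℂ × ℂ in 𝓝 (0, 0),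
      p.2 * Complex.exp (l p) ^ 3 + Complex.exp (l p) ^ 2 - Complex.exp (l p) - p.1 = 0)
    (hsq : ∀ᶠ p : ℂ × ℂ in 𝓝 (0, 0), s p ^ 2 * g3Delta p.1 p.2 = g3G p.2 (Complex.exp (l p))) :
    (fun p : ℂ × ℂ => ∑' k, hornG3DiagTerm r p.1 p.2 k) =ᶠ[𝓝 (0, 0)]
      fun p => Complex.exp (r * l p) * s p := by
  have him : ∀ᶠ p in 𝓝 (0, 0), |(l p).im| < Real.pi :=
    (Complex.continuous_im.continuousAt.comp hl).abs.eventually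
      (gt_mem_nhds (by simp [hl₀, Real.pi_pos]))
  have hre : ∀ᶠ p in 𝓝 (0, 0), 0 < (s p).re :=
    (Complex.continuous_re.continuousAt.comp hs).eventually (lt_mem_nhds (by simp [hs₀]))
  filter_upwards [eventually_hasSum_hornG3DiagTerm hl.cexp (by simp [hl₀]) hroot, hsq, him, hre]
    with p ⟨_, hΔ, _, hsum⟩ hsq him hre
  rw [(hsum r).tsum_eq, ← hsq, mul_div_cancel_right₀ _ hΔ, one_div, Complex.sq_cpow_two_inv hre,
    Complex.cpow_def_of_ne_zero (Complex.exp_ne_zero _),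
    Complex.log_exp (abs_lt.1 him).1 (abs_lt.1 him).2.le, mul_comm r]

theorem hasSum_hornG3DiagTerm_of_branches {r : ℂ} {U : Set (ℂ × ℂ)} (hU : IsOpen U)
    (hc : IsPreconnected U) (h₀ : (0, 0) ∈ U)
    (hsum : ∀ p ∈ U, Summable (hornG3DiagTerm r p.1 p.2))
    (hl : DifferentiableOn ℂ l U) (hl₀ : l (0, 0) = 0)
    (hroot : ∀ p ∈ U,
      p.2 * Complex.exp (l p) ^ 3 + Complex.exp (l p) ^ 2 - Complex.exp (l p) - p.1 = 0)
    (hs : DifferentiableOn ℂ s U) (hs₀ : s (0, 0) = 1)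
    (hsq : ∀ p ∈ U, s p ^ 2 * g3Delta p.1 p.2 = g3G p.2 (Complex.exp (l p))) :
    ∀ p ∈ U, HasSum (hornG3DiagTerm r p.1 p.2) (Complex.exp (r * l p) * s p) := by
  have hnhds := hU.mem_nhds h₀
  have hnear := eventually_tsum_hornG3DiagTerm_eq_of_branches r
    (hl.differentiableAt hnhds).continuousAt (hs.differentiableAt hnhds).continuousAt hl₀ hs₀
    (eventually_of_mem hnhds hroot) (eventually_of_mem hnhds hsq)
  have heqOn := eqOn_of_lineDifferentiableAt_of_isPreconnected hU hc
    (fun p hp v => lineDifferentiableAt_tsum_mul_pow_mul_pow hU hsum hp v)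
    (fun p hp v => (((hl.differentiableAt (hU.mem_nhds hp)).const_mul r).cexp.mul
      (hs.differentiableAt (hU.mem_nhds hp))).lineDifferentiableAt) h₀ hnear
  intro p hp
  rw [← show _ = Complex.exp (r * l p) * s p from heqOn hp]
  exact (hsum p hp).hasSum

end Branches

theorem mainTheorem1 :
    -- the coefficients of `G₃(r, 1 - r | x, y)` are well defined for all complex `r`,
    -- and for non-integral `r` they are those of the Horn series
    (∀ (r : ℂ) (m n : ℕ), Tendsto (fun s : ℂ => hornG3Coeff s (1 - s) m n) (𝓝[≠] r)
      (𝓝 (hornG3DiagCoeff r m n))) ∧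
    (∀ r : ℂ, (∀ k : ℤ, r ≠ k) → ∀ m n : ℕ,
      hornG3DiagCoeff r m n = hornG3Coeff r (1 - r) m n) ∧
    -- the formula near the origin, with principal powers, in a bidisc that does not depend on `r`
    (∃ ρ : ℝ, 0 < ρ ∧ ∃ f : ℂ × ℂ → ℂ,
      IsG3Root (Metric.ball 0 ρ ×ˢ Metric.ball 0 ρ) f ∧
      ∀ x y : ℂ, ‖x‖ < ρ → ‖y‖ < ρ →
        f (x, y) ∈ Complex.slitPlane ∧ g3Delta x y ≠ 0 ∧
        g3G y (f (x, y)) / g3Delta x y ∈ Complex.slitPlane ∧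
        ∀ r : ℂ, HasSum (hornG3DiagTerm r x y)
          (f (x, y) ^ r * (g3G y (f (x, y)) / g3Delta x y) ^ (1 / 2 : ℂ))) ∧
    -- the formula on every domain of convergence that carries holomorphic branches of the
    -- root `f`, of `log f` and of the square root of `g / Δ`
    (∀ (r : ℂ) (U : Set (ℂ × ℂ)) (f l s : ℂ × ℂ → ℂ),
      IsOpen U → IsPreconnected U → (0, 0) ∈ U →
      (∀ p ∈ U, Summable (hornG3DiagTerm r p.1 p.2)) →
      IsG3Root U f →
      DifferentiableOn ℂ l U → (∀ p ∈ U, Complex.exp (l p) = f p) → l (0, 0) = 0 →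
      DifferentiableOn ℂ s U → (∀ p ∈ U, s p ^ 2 * g3Delta p.1 p.2 = g3G p.2 (f p)) →
      s (0, 0) = 1 →
      ∀ p ∈ U, HasSum (hornG3DiagTerm r p.1 p.2) (Complex.exp (r * l p) * s p)) := by
  refine ⟨fun r m n => ?_, fun r hr m n => ?_, exists_bidisc_hasSum_hornG3DiagTerm, ?_⟩
  · rw [hornG3DiagCoeff_eq_hornG3PolyCoeff]
    exact tendsto_hornG3Coeff r m n
  · have hr' : r ∈ Complex.integerComplement := fun ⟨k, hk⟩ => hr k hk.symm
    rw [hornG3DiagCoeff_eq_hornG3PolyCoeff, hornG3Coeff_eq_hornG3PolyCoeff hr']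
  · intro r U f l s hU hc h₀ hsum hf hl hexp hl₀ hs hsq hs₀
    exact hasSum_hornG3DiagTerm_of_branches hU hc h₀ hsum hl hl₀
      (fun p hp => hexp p hp ▸ hf.cubic p hp) hs hs₀ fun p hp => hexp p hp ▸ hsq p hp
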